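/- Let $L$ be an even positive integer, $M$ a positive integer, $\beta = L^2$, $N = LM$, and let $\mathbb F$ be a field of characteristic $0$ (for instance $\mathbb R$ or $\mathbb C$). Let $V=\mathbb F^N$ with basis $\mathbf e_0,\dots,\mathbf e_{N-1}$. For an $L$-element subset $\mathfrak t=\{\mathfrak t(0)<\dots<\mathfrak t(L-1)\}$ of $\{0,1,\dots,N-1\}$ put $\mathbf e_{\mathfrak t}=\mathbf e_{\mathfrak t(0)}\wedge\dots\wedge\mathbf e_{\mathfrak t(L-1)}$, $$\Sigma\mathfrak t=\sum_{k=0}^{L-1}\mathfrak t(k),\qquad \overline\Sigma=\frac{L(N-1)}2,\qquad \widetilde\Delta\mathfrak t=\prod_{0\le j<k\le L-1}\frac{\mathfrak t(k)-\mathfrak t(j)}{k-j}.$$ For $\omega\in\Lambda^L V$ let the hyperpfaffian $\mathrm{PF}(\omega)$ be the coefficient of $\mathbf e_0\wedge\dots\wedge\mathbf e_{N-1}$ in $\omega^{\wedge M}/M!\in\Lambda^N V$. Then $$\mathrm{PF}\Big(\sum_{\mathfrak t\,:\,\Sigma\mathfrak t=\overline\Sigma}\widetilde\Delta\mathfrak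 t\;\mathbf e_{\mathfrak t}\Big)=\frac1{M!}\binom{\beta M/2}{\beta/2,\dots,\beta/2}=\frac{1}{M!}\,\frac{(\beta M/2)!}{\big((\beta/2)!\big)^M},$$ the sum being over all $L$-element subsets $\mathfrak t$ of $\{0,\dots,N-1\}$ with $\Sigma\mathfrak t=\overline\Sigma$. Moreover, for $\mathbb F=\mathbb C$ this hyperpfaffian is the partition function of the circular $\beta$-ensemble of $M$ particles: with $\mu$ the Haar probability measure on the unit circle $\mathbb T\subset\mathbb C$, $$Z:=\frac1{M!}\int_{\mathbb T^M}\prod_{1\le m<n\le M}|x_n-x_m|^{\beta}\,d\mu^M(\mathbf x)=\mathrm{PF}\Big(\sum_{\mathfrak t\,:\,\Sigma\mathfrak t=\overline\Sigma}\widetilde\Delta\mathfrak t\;\mathbf e_{\mathfrak t}\Big).$$ -/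

import Mathlib

open MeasureTheory
open scoped Nat

noncomputable section

namespace Hyperpfaffian

/-- The vector space `V = span {e_0, …, e_{N-1}}` over `𝕜`, with its preferred basis. -/
abbrev stdBasis (𝕜 : Type*) [Field 𝕜] (N : ℕ) : Module.Basis (Fin N) 𝕜 (Fin N → 𝕜) :=
  Pi.basisFun 𝕜 (Fin N)

/-- The Hodge star on the determinantal line `Λ^N V`, `N = dim V`: the coefficient of the volume
form `e_0 ∧ ⋯ ∧ e_{N-1}`. (It is defined on the whole exterior algebra, and is only applied to
elements of `Λ^N V`.) -/
def starTop {𝕜 : Type*} [Field 𝕜] {N : ℕ} (α : ExteriorAlgebra 𝕜 (Fin N → 𝕜)) : 𝕜 :=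
  (stdBasis 𝕜 N).ExteriorAlgebra.repr α Finset.univ

/-- The hyperpfaffian `PF ω = ∗ (ω ^ M / M!)` of an `L`-vector `ω` over the space `V` of
dimension `N = L M`; products and powers are those of the exterior algebra. -/
def PF {𝕜 : Type*} [Field 𝕜] {L M : ℕ} (ω : ⋀[𝕜]^L (Fin (L * M) → 𝕜)) : 𝕜 :=
  starTop ((M ! : 𝕜)⁻¹ • (ω : ExteriorAlgebra 𝕜 (Fin (L * M) → 𝕜)) ^ M)

/-- The increasing enumeration `t(0) < ⋯ < t(L-1)` of an `L`-element subset `t` of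
`{0, …, N-1}`, with values in `ℕ`. -/
def elt {N L : ℕ} (t : Set.powersetCard (Fin N) L) (k : Fin L) : ℕ :=
  (Set.powersetCard.ofFinEmbEquiv.symm t k : Fin N)

/-- `Σ t`, the sum of the elements of `t`. -/
def sigma {N L : ℕ} (t : Set.powersetCard (Fin N) L) : ℕ :=
  ∑ k : Fin L, elt t k

/-- `Σ̄ = L (N - 1) / 2`, as a rational number. -/
def sigmaBar (N L : ℕ) : ℚ :=
  (L : ℚ) * ((N : ℚ) - 1) / 2

/-- `Δ̃ t = ∏_{j < k} (t(k) - t(j)) / (k - j)`. -/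
def deltaTilde (𝕜 : Type*) [Field 𝕜] {N L : ℕ} (t : Set.powersetCard (Fin N) L) : 𝕜 :=
  ∏ j : Fin L, ∏ k ∈ Finset.Ioi j,
    ((elt t k : 𝕜) - (elt t j : 𝕜)) / (((k : ℕ) : 𝕜) - ((j : ℕ) : 𝕜))

/-- The `L`-vector `∑_{Σ t = Σ̄} Δ̃ t e_t`, the sum being over the `L`-element subsets `t` of
`{0, …, N-1}`, `N = L M`, with `Σ t = Σ̄`. -/
def circularGram (𝕜 : Type*) [Field 𝕜] (L M : ℕ) : ⋀[𝕜]^L (Fin (L * M) → 𝕜) :=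
  ∑ t : Set.powersetCard (Fin (L * M)) L with (sigma t : ℚ) = sigmaBar (L * M) L,
    deltaTilde 𝕜 t • (stdBasis 𝕜 (L * M)).exteriorPower L t

/-- The unit circle `𝕋` carries its Borel `σ`-algebra. -/
instance : MeasurableSpace Circle := borel Circle

instance : BorelSpace Circle := ⟨rfl⟩

/-- Haar probability measure on the unit circle. -/
def circleHaar : Measure Circle :=
  Measure.haarMeasure ⊤

instance : IsProbabilityMeasure circleHaar :=
  ⟨Measure.haarMeasure_self⟩

/-- The partition function
`Z = (1 / M!) ∫_{𝕋^M} ∏_{m < n} |x_n - x_m| ^ β dμ(x_1) ⋯ dμ(x_M)` of the circular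
`β`-ensemble of `M` particles (weight `1`). -/
def circularPartitionFunction (β M : ℕ) : ℝ :=
  (M ! : ℝ)⁻¹ * ∫ x : Fin M → Circle,
    ∏ m : Fin M, ∏ n ∈ Finset.Ioi m, ‖(x n : ℂ) - (x m : ℂ)‖ ^ β
      ∂(Measure.pi fun _ : Fin M => circleHaar)

end Hyperpfaffian

end

/-!
Let `w_k(x) = ∑ n, C(n, k) xⁿ e_n`. The minors of the matrix of binomial coefficients are the
numbers `Δ̃ t`, so the wedge of `w_0(x), …, w_{L-1}(x)` is `γ(x) = ∑ t, x ^ Σ t Δ̃ t e_t`. On the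
other hand `γ(x_1) ∧ ⋯ ∧ γ(x_M)` is, up to the monomial `∏ x_m ^ (L (L - 1) / 2)`, a confluent
Vandermonde determinant. Multiplied by the unitriangular matrix of coefficients of the Newton basis
of Hermite interpolation it becomes triangular, with determinant `∏_{m < n} (x_n - x_m) ^ L²`.

Restricting each factor `γ(x_m)` to the terms with `Σ t = Σ̄` amounts to extracting the coefficient
of `∏ x_m ^ Σ̄`. What has to be computed is therefore the constant term of the Laurent polynomial
`∏_{m ≠ n} (1 - x_m / x_n) ^ (β / 2)`. This is the case of equal exponents of Dyson's constant term
identity, proved by Good's argument: Lagrange interpolation of the constant `1`, evaluated at `0`,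
gives a recursion which multinomial coefficients satisfy too.

On the torus `∏_{m < n} |x_n - x_m| ^ β` is the same Laurent polynomial, and integration against
Haar measure extracts its constant term.
-/

namespace Hyperpfaffian

section ConfluentVandermonde

open Finset Matrix Polynomial

theorem det_vandermonde_natCast_eq_mul_det_choose {R : Type*} [CommRing R] [IsDomain R] {n : ℕ}
    (v : Fin n → ℕ) :
    (vandermonde fun i => (v i : R)).det =
      (∏ j : Fin n, ((j : ℕ)! : R)) * (of fun i j : Fin n => ((v i).choose j : R)).det := by
  rw [det_eval_matrixOfPolynomials_eq_det_vandermonde _ (fun j : Fin n => descPochhammer R j)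
    (fun j => descPochhammer_natDegree R j) (fun j => monic_descPochhammer R j), ← det_mul_row]
  congr 1
  ext i j
  simp only [of_apply]
  rw [descPochhammer_eval_eq_descFactorial, Nat.descFactorial_eq_factorial_mul_choose,
    Nat.cast_mul]

theorem det_choose_self (R : Type*) [CommRing R] (n : ℕ) :
    (of fun i j : Fin n => ((i : ℕ).choose j : R)).det = 1 := by
  rw [det_of_isLowerTriangular _ fun i j hij => ?_]
  · simp
  · have hij' : (i : ℕ) < j := hij
    simp [Nat.choose_eq_zero_of_lt hij']

theorem det_choose_eq_prod_div {𝕜 : Type*} [Field 𝕜] [CharZero 𝕜] {n : ℕ} (v : Fin n → ℕ) :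
    (of fun i j : Fin n => ((v i).choose j : 𝕜)).det =
      ∏ i : Fin n, ∏ j ∈ Ioi i,
        ((v j : 𝕜) - (v i : 𝕜)) / (((j : ℕ) : 𝕜) - ((i : ℕ) : 𝕜)) := by
  have hnum := det_vandermonde_natCast_eq_mul_det_choose (R := 𝕜) v
  have hden := det_vandermonde_natCast_eq_mul_det_choose (R := 𝕜) (fun i : Fin n => (i : ℕ))
  rw [det_choose_self, mul_one] at hden
  have hfact : (∏ j : Fin n, ((j : ℕ)! : 𝕜)) ≠ 0 :=
    prod_ne_zero_iff.2 fun j _ => Nat.cast_ne_zero.2 (Nat.factorial_ne_zero _)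
  simp_rw [prod_div_distrib]
  rw [← det_vandermonde, ← det_vandermonde (fun i : Fin n => ((i : ℕ) : 𝕜)), hnum, hden,
    mul_div_cancel_left₀ _ hfact]

/-- The decomposition of `{0, …, L M - 1}` into `M` consecutive blocks of length `L`: the index
`L m + k` corresponds to the position `k` in the block `m`. -/
def blockEquiv (L M : ℕ) : Fin (L * M) ≃ Fin M × Fin L :=
  (finCongr (Nat.mul_comm L M)).trans finProdFinEquiv.symm

theorem val_blockEquiv_symm {L M : ℕ} (p : Fin M × Fin L) :
    ((blockEquiv L M).symm p : ℕ) = p.2 + L * p.1 := rfl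

theorem val_eq_add_mul_blockEquiv {L M : ℕ} (i : Fin (L * M)) :
    (i : ℕ) = (blockEquiv L M i).2 + L * (blockEquiv L M i).1 := by
  rw [← val_blockEquiv_symm, Equiv.symm_apply_apply]

theorem blockEquiv_lex_of_lt {L M : ℕ} {i j : Fin (L * M)} (hij : i < j) :
    (blockEquiv L M i).1 < (blockEquiv L M j).1 ∨
      (blockEquiv L M i).1 = (blockEquiv L M j).1 ∧
        (blockEquiv L M i).2 < (blockEquiv L M j).2 := by
  have hval : (blockEquiv L M i).2 + L * (blockEquiv L M i).1 <
      (blockEquiv L M j).2 + L * ((blockEquiv L M j).1 : ℕ) := by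
    rwa [← val_eq_add_mul_blockEquiv, ← val_eq_add_mul_blockEquiv]
  have hdiv : (blockEquiv L M i).1 ≤ (blockEquiv L M j).1 :=
    Nat.div_le_div_right (c := L) (Fin.le_def.1 hij.le)
  refine hdiv.lt_or_eq.imp_right fun h => ⟨h, ?_⟩
  rw [h] at hval
  exact Nat.lt_of_add_lt_add_right hval

variable {R : Type*} [CommRing R]

theorem taylor_X_sub_C_pow_mul (r : R) (k : ℕ) (q : R[X]) :
    taylor r ((X - C r) ^ k * q) = X ^ k * taylor r q := by
  rw [taylor_mul, taylor_pow, map_sub, taylor_X, taylor_C, add_sub_cancel_right]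

theorem sum_choose_mul_pow_mul_coeff {N : ℕ} {p : R[X]} (hp : p.natDegree < N) (r : R) (k : ℕ) :
    ∑ n : Fin N, ((n : ℕ).choose k : R) * r ^ ((n : ℕ) - k) * p.coeff n =
      (taylor r p).coeff k := by
  rw [taylor_coeff, hasseDeriv_apply, sum_over_range' _ (by simp) N hp, eval_finsetSum,
    ← Fin.sum_univ_eq_sum_range
      (fun n => eval r (monomial (n - k) ((n.choose k : R) * p.coeff n)))]
  simp only [eval_monomial, mul_right_comm]

variable {M : ℕ}

/-- The Newton basis of Hermite interpolation at the nodes `x 0, x 1, …`, each of multiplicity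
`L`: the member of index `(m, k)` vanishes to order `L` at the nodes preceding `x m` and to order
`k` at `x m`. -/
noncomputable def newtonPoly (x : Fin M → R) (L : ℕ) (m : Fin M) (k : ℕ) : R[X] :=
  (X - C (x m)) ^ k * ∏ l ∈ Iio m, (X - C (x l)) ^ L

theorem monic_newtonPoly (x : Fin M → R) (L : ℕ) (m : Fin M) (k : ℕ) :
    (newtonPoly x L m k).Monic :=
  ((monic_X_sub_C _).pow _).mul (monic_prod_of_monic _ _ fun _ _ => (monic_X_sub_C _).pow _)

theorem natDegree_newtonPoly [Nontrivial R] (x : Fin M → R) (L : ℕ) (m : Fin M) (k : ℕ) :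
    (newtonPoly x L m k).natDegree = k + L * m := by
  rw [newtonPoly, ((monic_X_sub_C _).pow _).natDegree_mul
    (monic_prod_of_monic _ _ fun _ _ => (monic_X_sub_C _).pow _),
    natDegree_prod_of_monic _ _ fun _ _ => (monic_X_sub_C _).pow _]
  simp only [(monic_X_sub_C _).natDegree_pow, natDegree_X_sub_C, mul_one, sum_const, Fin.card_Iio,
    smul_eq_mul, mul_comm]

theorem X_sub_C_pow_dvd_newtonPoly_of_lt (x : Fin M → R) (L : ℕ) {m m' : Fin M} (h : m < m')
    (k : ℕ) : (X - C (x m)) ^ L ∣ newtonPoly x L m' k :=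
  (dvd_prod_of_mem (fun l => (X - C (x l)) ^ L) (mem_Iio.2 h)).mul_left _

theorem taylor_newtonPoly_coeff_self (x : Fin M → R) (L : ℕ) (m : Fin M) (k : ℕ) :
    (taylor (x m) (newtonPoly x L m k)).coeff k = ∏ l ∈ Iio m, (x m - x l) ^ L := by
  rw [newtonPoly, taylor_X_sub_C_pow_mul, coeff_X_pow_mul', if_pos le_rfl, Nat.sub_self,
    taylor_coeff_zero, eval_prod]
  simp only [eval_pow, eval_sub, eval_X, eval_C]

theorem taylor_newtonPoly_coeff_eq_zero (x : Fin M → R) {L : ℕ} {i j : Fin (L * M)}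
    (hij : i < j) :
    (taylor (x (blockEquiv L M i).1)
      (newtonPoly x L (blockEquiv L M j).1 (blockEquiv L M j).2)).coeff
        (blockEquiv L M i).2 = 0 := by
  have hdvd : (X - C (x (blockEquiv L M i).1)) ^ ((blockEquiv L M i).2 + 1 : ℕ) ∣
      newtonPoly x L (blockEquiv L M j).1 (blockEquiv L M j).2 := by
    rcases blockEquiv_lex_of_lt hij with hblock | ⟨hblock, hpos⟩
    · exact (pow_dvd_pow _ (blockEquiv L M i).2.2).trans
        (X_sub_C_pow_dvd_newtonPoly_of_lt x L hblock _)
    · rw [hblock]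
      exact (pow_dvd_pow _ hpos).mul_right _
  obtain ⟨q, hq⟩ := hdvd
  rw [hq, taylor_X_sub_C_pow_mul, coeff_X_pow_mul', if_neg (Nat.not_succ_le_self _)]

theorem prod_prod_Iio_sub_pow_eq_det_vandermonde_pow (x : Fin M → R) (n : ℕ) :
    ∏ m : Fin M, ∏ l ∈ Iio m, (x m - x l) ^ n = (vandermonde x).det ^ n := by
  simp only [det_vandermonde, prod_pow]
  rw [prod_comm' (t' := univ) (s' := Ioi) (by simp)]

theorem det_confluentVandermonde (x : Fin M → R) (L : ℕ) :
    (of fun i n : Fin (L * M) => ((n : ℕ).choose (blockEquiv L M i).2 : R) *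
        x (blockEquiv L M i).1 ^ ((n : ℕ) - (blockEquiv L M i).2)).det =
      (vandermonde x).det ^ L ^ 2 := by
  nontriviality R
  let P : Fin (L * M) → R[X] := fun j => newtonPoly x L (blockEquiv L M j).1 (blockEquiv L M j).2
  have hdeg (j : Fin (L * M)) : (P j).natDegree = j := by
    rw [natDegree_newtonPoly, ← val_eq_add_mul_blockEquiv]
  have hunitriangular : (of fun i j : Fin (L * M) => (P j).coeff i).det = 1 :=
    det_matrixOfPolynomials P hdeg fun j => monic_newtonPoly x L _ _
  rw [← mul_one (det _), ← hunitriangular, ← det_mul]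
  have hmul : (of fun i n : Fin (L * M) => ((n : ℕ).choose (blockEquiv L M i).2 : R) *
        x (blockEquiv L M i).1 ^ ((n : ℕ) - (blockEquiv L M i).2)) *
      (of fun i j : Fin (L * M) => (P j).coeff i) =
      of fun i j => (taylor (x (blockEquiv L M i).1) (P j)).coeff (blockEquiv L M i).2 := by
    ext i j
    exact sum_choose_mul_pow_mul_coeff ((hdeg j).trans_lt j.2) _ _
  rw [hmul, det_of_isLowerTriangular _ fun i j hij => ?_]
  · simp only [of_apply, P, taylor_newtonPoly_coeff_self]
    rw [(blockEquiv L M).prod_comp fun p => ∏ l ∈ Iio p.1, (x p.1 - x l) ^ L,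
      Fintype.prod_prod_type]
    simp only [prod_const, card_univ, Fintype.card_fin, ← prod_pow, ← pow_mul, ← sq,
      prod_prod_Iio_sub_pow_eq_det_vandermonde_pow]
  · exact taylor_newtonPoly_coeff_eq_zero x hij

theorem det_choose_mul_pow (x : Fin M → R) (L : ℕ) :
    (of fun i n : Fin (L * M) => ((n : ℕ).choose (blockEquiv L M i).2 : R) *
        x (blockEquiv L M i).1 ^ (n : ℕ)).det =
      (∏ m : Fin M, x m ^ (∑ k : Fin L, (k : ℕ))) * (vandermonde x).det ^ L ^ 2 := by
  have hscale : (∏ m : Fin M, x m ^ (∑ k : Fin L, (k : ℕ))) =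
      ∏ i : Fin (L * M), x (blockEquiv L M i).1 ^ ((blockEquiv L M i).2 : ℕ) := by
    rw [(blockEquiv L M).prod_comp fun p => x p.1 ^ (p.2 : ℕ), Fintype.prod_prod_type]
    simp only [prod_pow_eq_pow_sum]
  rw [← det_confluentVandermonde x L, hscale, ← det_mul_column]
  congr 1
  ext i n
  simp only [of_apply]
  rcases lt_or_ge (n : ℕ) (blockEquiv L M i).2 with h | h
  · simp [Nat.choose_eq_zero_of_lt h]
  · rw [mul_left_comm, ← pow_add, Nat.add_sub_cancel' h]

end ConfluentVandermonde

section Exterior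

open Finset Matrix

theorem list_prod_ιMulti {R V : Type*} [CommRing R] [AddCommGroup V] [Module R V] {L M : ℕ}
    (w : Fin M → Fin L → V) :
    (List.ofFn fun m => ExteriorAlgebra.ιMulti R L (w m)).prod =
      ExteriorAlgebra.ιMulti R (L * M) fun i => w (blockEquiv L M i).1 (blockEquiv L M i).2 := by
  have hblock (m : Fin M) (k : Fin L) (h : L * m + k < L * M) :
      blockEquiv L M ⟨L * m + k, h⟩ = (m, k) := by
    rw [← Equiv.eq_symm_apply]
    exact Fin.ext (Nat.add_comm _ _)
  simp only [ExteriorAlgebra.ιMulti_apply]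
  rw [List.ofFn_mul', List.prod_flatten, List.map_ofFn]
  simp only [Function.comp_def, hblock]

variable {𝕜 : Type*} [Field 𝕜]

theorem ofFinEmbEquiv_symm_ofCard_univ (N : ℕ) (h : #(univ : Finset (Fin N)) = N) :
    ⇑(Set.powersetCard.ofFinEmbEquiv.symm (Set.powersetCard.ofCard h)) = (id : Fin N → Fin N) := by
  set g : Fin N ↪o Fin N := Set.powersetCard.ofFinEmbEquiv.symm (Set.powersetCard.ofCard h)
  refine (g.strictMono.range_inj strictMono_id).1 ?_
  rw [(Finite.surjective_of_injective g.injective).range_eq, Set.range_id]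

theorem starTop_ιMulti_stdBasis (N : ℕ) :
    starTop (ExteriorAlgebra.ιMulti 𝕜 N (stdBasis 𝕜 N)) = 1 := by
  have hbasis := ExteriorAlgebra.basis_apply_ofCard (stdBasis 𝕜 N) (card_fin N)
  rw [ExteriorAlgebra.ιMulti_family, ofFinEmbEquiv_symm_ofCard_univ, Function.comp_id] at hbasis
  rw [starTop, ← hbasis, Module.Basis.repr_self, Finsupp.single_eq_same]

theorem starTop_ιMulti {N : ℕ} (v : Fin N → Fin N → 𝕜) :
    starTop (ExteriorAlgebra.ιMulti 𝕜 N v) = (of v).det := by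
  let f : (Fin N → 𝕜) [⋀^Fin N]→ₗ[𝕜] 𝕜 :=
    ((stdBasis 𝕜 N).ExteriorAlgebra.coord univ).compAlternatingMap (ExteriorAlgebra.ιMulti 𝕜 N)
  have hf : f v = f (stdBasis 𝕜 N) • (stdBasis 𝕜 N).det v :=
    congrArg (· v) (f.eq_smul_basis_det (stdBasis 𝕜 N))
  have hnormalized : f (stdBasis 𝕜 N) = 1 := starTop_ιMulti_stdBasis N
  rw [hnormalized, one_smul, Module.Basis.det_apply, ← det_transpose] at hf
  exact hf

/-- The multilinear map `(α_0, …, α_{M-1}) ↦ ∗ (α_0 ∧ ⋯ ∧ α_{M-1})`, which polarizes the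
hyperpfaffian. -/
noncomputable def starProd (𝕜 : Type*) [Field 𝕜] (N M : ℕ) :
    MultilinearMap 𝕜 (fun _ : Fin M => ExteriorAlgebra 𝕜 (Fin N → 𝕜)) 𝕜 :=
  ((stdBasis 𝕜 N).ExteriorAlgebra.coord univ).compMultilinearMap
    (MultilinearMap.mkPiAlgebraFin 𝕜 M _)

theorem starProd_apply {N M : ℕ} (α : Fin M → ExteriorAlgebra 𝕜 (Fin N → 𝕜)) :
    starProd 𝕜 N M α = starTop (List.ofFn α).prod := rfl

theorem PF_eq_starProd {L M : ℕ} (ω : ⋀[𝕜]^L (Fin (L * M) → 𝕜)) :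
    PF ω = (M ! : 𝕜)⁻¹ * starProd 𝕜 (L * M) M fun _ => ω := by
  rw [starProd_apply, List.ofFn_const, List.prod_replicate]
  exact congrArg (· univ) (map_smul (stdBasis 𝕜 (L * M)).ExteriorAlgebra.repr _ _)

theorem starProd_ιMulti {L M : ℕ} (w : Fin M → Fin L → Fin (L * M) → 𝕜) :
    starProd 𝕜 (L * M) M (fun m => ExteriorAlgebra.ιMulti 𝕜 L (w m)) =
      (of fun i => w (blockEquiv L M i).1 (blockEquiv L M i).2).det := by
  rw [starProd_apply, list_prod_ιMulti, starTop_ιMulti]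

theorem ιMulti_eq_sum_minors {N L : ℕ} (v : Fin L → Fin N → 𝕜) :
    ExteriorAlgebra.ιMulti 𝕜 L v = ∑ t : Set.powersetCard (Fin N) L,
      (of fun j k => v k (Set.powersetCard.ofFinEmbEquiv.symm t j)).det •
        ((stdBasis 𝕜 N).exteriorPower L t : ExteriorAlgebra 𝕜 (Fin N → 𝕜)) := by
  rw [← exteriorPower.ιMulti_apply_coe, ← ((stdBasis 𝕜 N).exteriorPower L).sum_repr
    (exteriorPower.ιMulti 𝕜 L v), Submodule.coe_sum]
  refine sum_congr rfl fun t _ => ?_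
  rw [Submodule.coe_smul, exteriorPower.basis_repr_apply, exteriorPower.ιMultiDual_apply_ιMulti,
    ← det_transpose]
  rfl

/-- The term `Δ̃ t e_t` of `circularGram`, as an element of the exterior algebra, where `starProd`
takes its arguments. -/
noncomputable def gramTerm (𝕜 : Type*) [Field 𝕜] {N L : ℕ} (t : Set.powersetCard (Fin N) L) :
    ExteriorAlgebra 𝕜 (Fin N → 𝕜) :=
  deltaTilde 𝕜 t • ((stdBasis 𝕜 N).exteriorPower L t : ExteriorAlgebra 𝕜 (Fin N → 𝕜))

theorem coe_circularGram (L M : ℕ) :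
    (circularGram 𝕜 L M : ExteriorAlgebra 𝕜 (Fin (L * M) → 𝕜)) =
      ∑ t : Set.powersetCard (Fin (L * M)) L with (sigma t : ℚ) = sigmaBar (L * M) L,
        gramTerm 𝕜 t := by
  simp only [circularGram, gramTerm, Submodule.coe_sum, Submodule.coe_smul]

theorem sigmaBar_eq {L M : ℕ} (hL : Even L) (hM : 0 < M) :
    sigmaBar (L * M) L = ((∑ k : Fin L, (k : ℕ)) + L ^ 2 / 2 * (M - 1) : ℕ) := by
  have hsum : ((∑ k : Fin L, (k : ℕ) : ℕ) : ℚ) = L * (L - 1) / 2 := by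
    rw [Fin.sum_univ_eq_sum_range (fun k => k), sum_range_id, ← Nat.choose_two_right,
      Nat.cast_choose_two]
  have hsq : 2 ∣ L ^ 2 := (hL.pow_of_ne_zero two_ne_zero).two_dvd
  rw [Nat.cast_add, hsum, Nat.cast_mul, Nat.cast_div_charZero hsq, Nat.cast_pred hM, sigmaBar]
  push_cast
  ring

variable [CharZero 𝕜]

theorem ιMulti_choose_mul_pow (N L : ℕ) (x : 𝕜) :
    (ExteriorAlgebra.ιMulti 𝕜 L fun (k : Fin L) (n : Fin N) =>
        ((n : ℕ).choose k : 𝕜) * x ^ (n : ℕ)) =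
      ∑ t : Set.powersetCard (Fin N) L, x ^ sigma t • gramTerm 𝕜 t := by
  rw [ιMulti_eq_sum_minors]
  refine sum_congr rfl fun t _ => ?_
  rw [gramTerm, smul_smul, deltaTilde, ← det_choose_eq_prod_div, sigma, ← prod_pow_eq_pow_sum,
    ← det_mul_column]
  simp only [elt, of_apply, mul_comm]

theorem sum_prod_pow_sigma_mul_starProd {L M : ℕ} (x : Fin M → 𝕜) :
    ∑ T : Fin M → Set.powersetCard (Fin (L * M)) L,
        (∏ m, x m ^ sigma (T m)) * starProd 𝕜 (L * M) M (fun m => gramTerm 𝕜 (T m)) =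
      (∏ m, x m ^ (∑ k : Fin L, (k : ℕ))) * (vandermonde x).det ^ L ^ 2 := by
  have hdet := starProd_ιMulti fun m (k : Fin L) (n : Fin (L * M)) =>
    ((n : ℕ).choose k : 𝕜) * x m ^ (n : ℕ)
  simp only [ιMulti_choose_mul_pow] at hdet
  rw [MultilinearMap.map_sum] at hdet
  simp only [MultilinearMap.map_smul_univ, smul_eq_mul] at hdet
  rw [hdet, det_choose_mul_pow]

theorem sum_monomial_sigma_starProd (L M : ℕ) :
    ∑ T : Fin M → Set.powersetCard (Fin (L * M)) L,
        MvPolynomial.monomial (Finsupp.equivFunOnFinite.symm fun m => sigma (T m))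
          (starProd 𝕜 (L * M) M fun m => gramTerm 𝕜 (T m)) =
      MvPolynomial.monomial (Finsupp.equivFunOnFinite.symm fun _ => ∑ k : Fin L, (k : ℕ)) 1 *
        (vandermonde (MvPolynomial.X : Fin M → MvPolynomial (Fin M) 𝕜)).det ^ L ^ 2 := by
  refine MvPolynomial.funext fun x => ?_
  simp only [map_sum, map_mul, map_pow, det_vandermonde, map_prod, map_sub, MvPolynomial.eval_X,
    MvPolynomial.eval_monomial, Finsupp.prod_fintype _ _ (fun _ => pow_zero _),
    Finsupp.equivFunOnFinite_symm_apply_apply, one_mul]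
  rw [← det_vandermonde, ← sum_prod_pow_sigma_mul_starProd]
  exact sum_congr rfl fun T _ => mul_comm _ _

theorem PF_circularGram_eq_coeff {L M : ℕ} (hL : Even L) (hM : 0 < M) :
    PF (circularGram 𝕜 L M) = (M ! : 𝕜)⁻¹ *
      ((vandermonde (MvPolynomial.X : Fin M → MvPolynomial (Fin M) 𝕜)).det ^ L ^ 2).coeff
        (Finsupp.equivFunOnFinite.symm fun _ => L ^ 2 / 2 * (M - 1)) := by
  classical
  set S : ℕ := (∑ k : Fin L, (k : ℕ)) + L ^ 2 / 2 * (M - 1) with hS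
  have hexp : (Finsupp.equivFunOnFinite.symm fun _ : Fin M => S) =
      (Finsupp.equivFunOnFinite.symm fun _ : Fin M => ∑ k : Fin L, (k : ℕ)) +
        Finsupp.equivFunOnFinite.symm fun _ => L ^ 2 / 2 * (M - 1) := by
    ext
    rfl
  have hcoeff := congrArg (MvPolynomial.coeff (Finsupp.equivFunOnFinite.symm fun _ : Fin M => S))
    (sum_monomial_sigma_starProd (𝕜 := 𝕜) L M)
  nth_rewrite 2 [hexp] at hcoeff
  rw [MvPolynomial.coeff_monomial_mul, one_mul, MvPolynomial.coeff_sum] at hcoeff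
  rw [PF_eq_starProd, ← hcoeff, coe_circularGram, MultilinearMap.map_sum_finset]
  simp only [sigmaBar_eq hL hM, ← hS, Nat.cast_inj, MvPolynomial.coeff_monomial,
    Finsupp.equivFunOnFinite.symm.injective.eq_iff, funext_iff, ← sum_filter]
  congr 2
  ext T
  simp

end Exterior

section Dyson

open Finset MvPolynomial

variable {R σ : Type*} [CommRing R]

theorem degreeOf_X_sub_X_le (i j : σ) : degreeOf j (X j - X i : MvPolynomial σ R) ≤ 1 := by
  rcases subsingleton_or_nontrivial R with _ | _
  · simp [Subsingleton.elim (X j - X i : MvPolynomial σ R) 0]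
  refine (degreeOf_sub_le _ _ _).trans (max_le (degreeOf_X_self j).le ?_)
  rcases eq_or_ne j i with rfl | hji
  · exact (degreeOf_X_self j).le
  · rw [degreeOf_X_of_ne hji]
    exact zero_le_one

theorem degreeOf_X_sub_X_pow_mul_le (i j : σ) (k : ℕ) (p : MvPolynomial σ R) :
    degreeOf j ((X j - X i) ^ k * p) ≤ degreeOf j p + k := by
  have hpow : degreeOf j ((X j - X i : MvPolynomial σ R) ^ k) ≤ k :=
    (degreeOf_pow_le _ _ _).trans (mul_le_of_le_one_right k.zero_le (degreeOf_X_sub_X_le i j))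
  exact (degreeOf_mul_le _ _ _).trans (by lia)

theorem coeff_X_sub_X_mul {i j : σ} (hij : i ≠ j) {m : σ →₀ ℕ} {p : MvPolynomial σ R}
    (hp : degreeOf j p ≤ m j) :
    coeff (m + Finsupp.single j 1) ((X j - X i) * p) = coeff m p := by
  have hX : degreeOf j (X i * p) < (m + Finsupp.single j 1 : σ →₀ ℕ) j := by
    rw [mul_comm, degreeOf_mul_X_of_ne _ hij.symm, Finsupp.add_apply, Finsupp.single_eq_same]
    exact Nat.lt_succ_of_le hp
  have hcoeff : coeff (m + Finsupp.single j 1) (X i * p) = 0 :=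
    notMem_support_iff.1 fun h => (le_degreeOf_of_mem_support j h).not_gt hX
  rw [sub_mul, coeff_sub, hcoeff, sub_zero, add_comm, coeff_X_mul]

theorem coeff_X_sub_X_pow_mul {i j : σ} (hij : i ≠ j) (k : ℕ) {m : σ →₀ ℕ}
    {p : MvPolynomial σ R} (hp : degreeOf j p ≤ m j) :
    coeff (m + Finsupp.single j k) ((X j - X i) ^ k * p) = coeff m p := by
  induction k with
  | zero => simp
  | succ k ih =>
    have hdeg : degreeOf j ((X j - X i) ^ k * p) ≤ (m + Finsupp.single j k) j := by
      rw [Finsupp.add_apply, Finsupp.single_eq_same]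
      exact (degreeOf_X_sub_X_pow_mul_le i j k p).trans (Nat.add_le_add_right hp k)
    rw [Finsupp.single_add, ← add_assoc, pow_succ', mul_assoc, coeff_X_sub_X_mul hij hdeg, ih]

theorem coeff_prod_X_sub_X_pow_mul {j : σ} {s : Finset σ} (hj : j ∉ s) (a : σ → ℕ)
    {m : σ →₀ ℕ} {p : MvPolynomial σ R} (hp : degreeOf j p ≤ m j) :
    coeff (m + ∑ i ∈ s, Finsupp.single j (a i)) ((∏ i ∈ s, (X j - X i) ^ a i) * p) =
      coeff m p := by
  classical
  induction s using Finset.induction_on generalizing m p with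
  | empty => simp
  | insert i s hi ih =>
    obtain ⟨hji, hjs⟩ := not_or.1 (mem_insert.not.1 hj)
    have hdeg : degreeOf j ((X j - X i) ^ a i * p) ≤ (m + Finsupp.single j (a i)) j := by
      rw [Finsupp.add_apply, Finsupp.single_eq_same]
      exact (degreeOf_X_sub_X_pow_mul_le i j _ p).trans (Nat.add_le_add_right hp _)
    rw [prod_insert hi, sum_insert hi, ← add_assoc, mul_comm (_ ^ _), mul_assoc, ih hjs hdeg,
      coeff_X_sub_X_pow_mul (Ne.symm hji) _ hp]

theorem sum_prod_div_sub_eq_one [DecidableEq σ] {K : Type*} [Field K] {s : Finset σ}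
    (hs : s.Nonempty) {v : σ → K} (hv : Set.InjOn v s) :
    ∑ j ∈ s, ∏ i ∈ s.erase j, v i / (v i - v j) = 1 := by
  have hbasis := congrArg (Polynomial.eval 0) (Lagrange.sum_basis hv hs)
  rw [Polynomial.eval_finsetSum, Polynomial.eval_one] at hbasis
  rw [← hbasis]
  refine sum_congr rfl fun j _ => ?_
  rw [Lagrange.basis, Polynomial.eval_prod]
  refine prod_congr rfl fun i _ => ?_
  simp only [Lagrange.basisDivisor, Polynomial.eval_mul, Polynomial.eval_C, Polynomial.eval_sub,
    Polynomial.eval_X, zero_sub]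
  rw [← neg_sub (v j), div_neg, mul_neg, mul_comm, div_eq_mul_inv]

variable [DecidableEq σ]

theorem sum_update_pred {s : Finset σ} {a : σ → ℕ} {j : σ} (hj : j ∈ s) (ha : 0 < a j) :
    ∑ i ∈ s, Function.update a j (a j - 1) i = ∑ i ∈ s, a i - 1 := by
  rw [sum_update_of_mem hj, sdiff_singleton_eq_erase, ← add_sum_erase s a hj,
    Nat.sub_add_comm ha]

theorem prod_factorial_mul_multinomial_update {s : Finset σ} {a : σ → ℕ} {j : σ} (hj : j ∈ s)
    (ha : 0 < a j) :
    (∏ i ∈ s, (a i)!) * Nat.multinomial s (Function.update a j (a j - 1)) =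
      a j * (∑ i ∈ s, a i - 1)! := by
  have hprod : ∏ i ∈ s, (a i)! = a j * ∏ i ∈ s, (Function.update a j (a j - 1) i)! := by
    rw [← mul_prod_erase s _ hj, ← mul_prod_erase s _ hj, Function.update_self, ← mul_assoc,
      Nat.mul_factorial_pred ha.ne']
    congr 1
    exact prod_congr rfl fun i hi => by rw [Function.update_of_ne (ne_of_mem_erase hi)]
  rw [hprod, mul_assoc, Nat.multinomial_spec, sum_update_pred hj ha]

theorem multinomial_eq_sum_update {s : Finset σ} (hs : s.Nonempty) {a : σ → ℕ}
    (ha : ∀ i ∈ s, 0 < a i) :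
    Nat.multinomial s a = ∑ j ∈ s, Nat.multinomial s (Function.update a j (a j - 1)) := by
  have hpos : 0 < ∏ i ∈ s, (a i)! := prod_pos fun i _ => Nat.factorial_pos _
  refine Nat.eq_of_mul_eq_mul_left hpos ?_
  rw [Nat.multinomial_spec, mul_sum,
    sum_congr rfl fun j hj => prod_factorial_mul_multinomial_update hj (ha j hj), ← sum_mul,
    Nat.mul_factorial_pred (sum_pos ha hs).ne']

/-- The polynomial `∏_{i ≠ j} (X_j - X_i) ^ a_i`, `i` and `j` ranging over `s`. It is Dyson's
Laurent polynomial `∏_{i ≠ j} (1 - X_i / X_j) ^ a_i` with the denominators cleared. -/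
noncomputable def dysonPoly (R : Type*) [CommRing R] (s : Finset σ) (a : σ → ℕ) :
    MvPolynomial σ R :=
  ∏ i ∈ s, ∏ j ∈ s.erase i, (X j - X i) ^ a i

/-- The exponent of the monomial `∏_{i ≠ j} X_j ^ a_i`, `i` and `j` ranging over `s`. The
corresponding coefficient of `dysonPoly R s a` is the constant term of Dyson's Laurent
polynomial. -/
noncomputable def dysonExponent (s : Finset σ) (a : σ → ℕ) : σ →₀ ℕ :=
  ∑ i ∈ s, ∑ j ∈ s.erase i, Finsupp.single j (a i)

theorem map_dysonPoly {S : Type*} [CommRing S] (f : R →+* S) (s : Finset σ) (a : σ → ℕ) :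
    map f (dysonPoly R s a) = dysonPoly S s a := by
  simp only [dysonPoly, map_prod, map_pow, map_sub, map_X]

theorem dysonPoly_eq_prod_mul_update {s : Finset σ} {a : σ → ℕ} {j : σ} (hj : j ∈ s)
    (ha : 0 < a j) :
    dysonPoly R s a =
      (∏ i ∈ s.erase j, (X i - X j)) * dysonPoly R s (Function.update a j (a j - 1)) := by
  rw [dysonPoly, dysonPoly, ← mul_prod_erase s _ hj, ← mul_prod_erase s _ hj, ← mul_assoc]
  congr 1
  · simp only [Function.update_self, ← prod_mul_distrib, mul_pow_sub_one ha.ne']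
  · exact prod_congr rfl fun i hi => by rw [Function.update_of_ne (ne_of_mem_erase hi)]

theorem dysonExponent_eq_sum_add_update {s : Finset σ} {a : σ → ℕ} {j : σ} (hj : j ∈ s)
    (ha : 0 < a j) :
    dysonExponent s a =
      (∑ i ∈ s.erase j, Finsupp.single i 1) +
        dysonExponent s (Function.update a j (a j - 1)) := by
  rw [dysonExponent, dysonExponent, ← add_sum_erase s _ hj, ← add_sum_erase s _ hj, ← add_assoc]
  congr 1
  · simp only [Function.update_self, ← sum_add_distrib, ← Finsupp.single_add,
      Nat.add_sub_cancel' ha]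
  · exact sum_congr rfl fun i hi => by rw [Function.update_of_ne (ne_of_mem_erase hi)]

-- Both sides have integer coefficients, so it suffices to divide in the field `ℚ(X)`.
theorem dysonPoly_eq_sum_update {s : Finset σ} (hs : s.Nonempty) {a : σ → ℕ}
    (ha : ∀ i ∈ s, 0 < a i) :
    dysonPoly R s a =
      ∑ j ∈ s, (∏ i ∈ s.erase j, X i) * dysonPoly R s (Function.update a j (a j - 1)) := by
  suffices h : dysonPoly ℤ s a =
      ∑ j ∈ s, (∏ i ∈ s.erase j, X i) * dysonPoly ℤ s (Function.update a j (a j - 1)) by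
    simpa only [map_dysonPoly, map_sum, map_mul, map_prod, map_X] using
      congrArg (map (Int.castRingHom R)) h
  let ψ := algebraMap (MvPolynomial σ ℤ) (FractionRing (MvPolynomial σ ℤ))
  have hψ : Function.Injective ψ := IsFractionRing.injective _ _
  have hX : Function.Injective fun i : σ => ψ (X i) := hψ.comp X_injective
  refine hψ ?_
  rw [← mul_one (ψ (dysonPoly ℤ s a)), ← sum_prod_div_sub_eq_one hs hX.injOn, mul_sum, map_sum]
  refine sum_congr rfl fun j hj => ?_
  have hne : ∏ i ∈ s.erase j, (ψ (X i) - ψ (X j)) ≠ 0 :=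
    prod_ne_zero_iff.2 fun i hi => sub_ne_zero.2 (hX.ne (ne_of_mem_erase hi))
  rw [dysonPoly_eq_prod_mul_update hj (ha j hj), prod_div_distrib]
  simp only [map_mul, map_prod, map_sub]
  field_simp

theorem coeff_dysonPoly_eq_sum_update {s : Finset σ} (hs : s.Nonempty) {a : σ → ℕ}
    (ha : ∀ i ∈ s, 0 < a i) :
    coeff (dysonExponent s a) (dysonPoly R s a) =
      ∑ j ∈ s, coeff (dysonExponent s (Function.update a j (a j - 1)))
        (dysonPoly R s (Function.update a j (a j - 1))) := by
  rw [dysonPoly_eq_sum_update hs ha, coeff_sum]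
  refine sum_congr rfl fun j hj => ?_
  have hmonomial : ∏ i ∈ s.erase j, (X i : MvPolynomial σ R) =
      monomial (∑ i ∈ s.erase j, Finsupp.single i 1) 1 := by
    rw [monomial_sum_one]
    rfl
  rw [hmonomial, dysonExponent_eq_sum_add_update hj (ha j hj), coeff_monomial_mul, one_mul]

theorem degreeOf_dysonPoly_of_notMem {j : σ} {s : Finset σ} (hj : j ∉ s) (a : σ → ℕ) :
    degreeOf j (dysonPoly R s a) = 0 := by
  have hfactor (i : σ) (hi : i ∈ s) (l : σ) (hl : l ∈ s.erase i) :
      degreeOf j ((X l - X i : MvPolynomial σ R) ^ a i) = 0 := by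
    have hjl : j ≠ l := fun h => hj (h ▸ mem_of_mem_erase hl)
    have hji : j ≠ i := fun h => hj (h ▸ hi)
    have hsub : degreeOf j (X l - X i : MvPolynomial σ R) = 0 := by
      simpa [degreeOf_X_of_ne hjl, degreeOf_X_of_ne hji] using
        degreeOf_sub_le j (X l : MvPolynomial σ R) (X i)
    exact Nat.le_zero.1 ((degreeOf_pow_le _ _ _).trans_eq (by rw [hsub, mul_zero]))
  refine Nat.le_zero.1 ((degreeOf_prod_le _ _ _).trans_eq (sum_eq_zero fun i hi => ?_))
  exact Nat.le_zero.1 ((degreeOf_prod_le _ _ _).trans_eq (sum_eq_zero (hfactor i hi)))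

theorem dysonPoly_insert {j : σ} {s : Finset σ} (hj : j ∉ s) {a : σ → ℕ} (ha : a j = 0) :
    dysonPoly R (insert j s) a = (∏ i ∈ s, (X j - X i) ^ a i) * dysonPoly R s a := by
  simp only [dysonPoly, prod_insert hj, ha, pow_zero, prod_const_one, one_mul,
    ← prod_mul_distrib]
  refine prod_congr rfl fun i hi => ?_
  rw [erase_insert_of_ne (ne_of_mem_of_not_mem hi hj).symm,
    prod_insert fun h => hj (mem_of_mem_erase h)]

theorem dysonExponent_insert {j : σ} {s : Finset σ} (hj : j ∉ s) {a : σ → ℕ} (ha : a j = 0) :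
    dysonExponent (insert j s) a =
      dysonExponent s a + ∑ i ∈ s, Finsupp.single j (a i) := by
  simp only [dysonExponent, sum_insert hj, ha, Finsupp.single_zero, sum_const_zero, zero_add,
    ← sum_add_distrib]
  refine sum_congr rfl fun i hi => ?_
  rw [erase_insert_of_ne (ne_of_mem_of_not_mem hi hj).symm,
    sum_insert fun h => hj (mem_of_mem_erase h), add_comm]

theorem coeff_dysonPoly_insert {j : σ} {s : Finset σ} (hj : j ∉ s) {a : σ → ℕ} (ha : a j = 0) :
    coeff (dysonExponent (insert j s) a) (dysonPoly R (insert j s) a) =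
      coeff (dysonExponent s a) (dysonPoly R s a) := by
  rw [dysonPoly_insert hj ha, dysonExponent_insert hj ha, coeff_prod_X_sub_X_pow_mul hj]
  rw [degreeOf_dysonPoly_of_notMem hj]
  exact Nat.zero_le _

theorem coeff_dysonPoly (s : Finset σ) (a : σ → ℕ) :
    coeff (dysonExponent s a) (dysonPoly R s a) = (Nat.multinomial s a : R) := by
  induction hn : #s + ∑ i ∈ s, a i using Nat.strong_induction_on generalizing s a with
  | _ n ih =>
  subst hn
  rcases s.eq_empty_or_nonempty with rfl | hs
  · simp [dysonPoly, dysonExponent]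
  by_cases ha : ∀ i ∈ s, 0 < a i
  · rw [coeff_dysonPoly_eq_sum_update hs ha, multinomial_eq_sum_update hs ha, Nat.cast_sum]
    refine sum_congr rfl fun j hj => ih _ ?_ _ _ rfl
    rw [sum_update_pred hj (ha j hj)]
    exact Nat.add_lt_add_left (Nat.sub_one_lt (sum_pos ha hs).ne') _
  · simp only [not_forall, Nat.pos_iff_ne_zero, not_not] at ha
    obtain ⟨j, hj, haj⟩ := ha
    rw [← insert_erase hj, coeff_dysonPoly_insert (notMem_erase j s) haj,
      Nat.multinomial_insert (notMem_erase j s), haj, Nat.choose_zero_right, one_mul]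
    refine ih _ ?_ _ _ rfl
    rw [sum_erase s haj]
    exact Nat.add_lt_add_right (card_erase_lt_of_mem hj) _

theorem dysonExponent_univ_const (M k : ℕ) :
    dysonExponent (univ : Finset (Fin M)) (fun _ => k) =
      Finsupp.equivFunOnFinite.symm fun _ => k * (M - 1) := by
  ext l
  simp [dysonExponent, Finsupp.finsetSum_apply, Finsupp.single_apply, sum_ite, filter_ne,
    mul_comm]

theorem dysonPoly_univ_const (R : Type*) [CommRing R] (M k : ℕ) :
    dysonPoly R (univ : Finset (Fin M)) (fun _ => k) =
      ∏ m : Fin M, ∏ n ∈ Ioi m, ((X n - X m) * (X m - X n)) ^ k := by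
  simp only [dysonPoly, ← compl_singleton, mul_pow]
  rw [prod_prod_Ioi_mul_eq_prod_prod_off_diag fun n m : Fin M => (X n - X m : MvPolynomial _ R) ^ k]

theorem det_vandermonde_X_pow_eq_dysonPoly (R : Type*) [CommRing R] (M : ℕ) {k : ℕ}
    (hk : Even k) :
    (Matrix.vandermonde (X : Fin M → MvPolynomial (Fin M) R)).det ^ (2 * k) =
      dysonPoly R univ fun _ => k := by
  rw [dysonPoly_univ_const, Matrix.det_vandermonde]
  simp only [← prod_pow]
  refine prod_congr rfl fun m _ => prod_congr rfl fun n _ => ?_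
  rw [← neg_sub (X n), mul_neg, hk.neg_pow, pow_mul, sq]

theorem PF_circularGram {𝕜 : Type*} [Field 𝕜] [CharZero 𝕜] {L M : ℕ} (hL : Even L)
    (hM : 0 < M) :
    PF (circularGram 𝕜 L M) =
      (M ! : 𝕜)⁻¹ * (Nat.multinomial univ (fun _ : Fin M => L ^ 2 / 2) : 𝕜) := by
  have hdvd : 4 ∣ L ^ 2 := pow_dvd_pow_of_dvd hL.two_dvd 2
  have hsq : L ^ 2 = 2 * (L ^ 2 / 2) := by omega
  have heven : Even (L ^ 2 / 2) := by
    rw [even_iff_two_dvd]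
    omega
  rw [PF_circularGram_eq_coeff hL hM, ← dysonExponent_univ_const, ← coeff_dysonPoly,
    ← det_vandermonde_X_pow_eq_dysonPoly 𝕜 M heven, ← hsq]

end Dyson

section Circle

open Finset

instance : circleHaar.IsHaarMeasure :=
  inferInstanceAs (Measure.haarMeasure _).IsHaarMeasure

-- For `k ≠ 0` some rotation multiplies `z ^ k` by `-1`, so the integral is its own negative.
theorem integral_circle_zpow (k : ℤ) :
    ∫ z : Circle, (z : ℂ) ^ k ∂circleHaar = if k = 0 then 1 else 0 := by
  split_ifs with hk
  · simp [hk]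
  · set g : Circle := Circle.exp (Real.pi / k)
    have hg : (g : ℂ) ^ k = -1 := by
      rw [← Circle.coe_zpow, ← Circle.exp_intCast_mul,
        mul_div_cancel₀ _ (Int.cast_ne_zero.2 hk), Circle.coe_exp, Complex.exp_pi_mul_I]
    have h := integral_mul_left_eq_self (μ := circleHaar) (fun z : Circle => (z : ℂ) ^ k) g
    simp only [Circle.coe_mul, mul_zpow, hg, neg_one_mul, integral_neg] at h
    exact self_eq_neg.1 h.symm

theorem integrable_circle_zpow (k : ℤ) : Integrable (fun z : Circle => (z : ℂ) ^ k) circleHaar := by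
  have hcoe : Continuous fun z : Circle => (z : ℂ) := by fun_prop
  exact (hcoe.zpow₀ k fun z => .inl z.coe_ne_zero).integrable_of_hasCompactSupport
    (.of_compactSpace _)

variable {ι : Type*} [Fintype ι]

theorem integral_torus_prod_zpow (k : ι → ℤ) :
    ∫ x : ι → Circle, ∏ m, (x m : ℂ) ^ k m ∂(Measure.pi fun _ => circleHaar) =
      if k = 0 then 1 else 0 := by
  classical
  rw [integral_fintype_prod_eq_prod fun m (z : Circle) => (z : ℂ) ^ k m]
  simp only [integral_circle_zpow, prod_ite_zero, mem_univ, true_imp_iff, prod_const_one,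
    funext_iff, Pi.zero_apply]

theorem integrable_torus_prod_zpow (k : ι → ℤ) :
    Integrable (fun x : ι → Circle => ∏ m, (x m : ℂ) ^ k m) (Measure.pi fun _ => circleHaar) :=
  Integrable.fintype_prod (f := fun m (z : Circle) => (z : ℂ) ^ k m) fun m =>
    integrable_circle_zpow (k m)

theorem eval_mul_prod_zpow_neg (p : MvPolynomial ι ℂ) (d : ι →₀ ℕ) (x : ι → Circle) :
    MvPolynomial.eval (fun m => (x m : ℂ)) p * ∏ m, (x m : ℂ) ^ (-d m : ℤ) =
      ∑ e ∈ p.support, p.coeff e * ∏ m, (x m : ℂ) ^ (e m - d m : ℤ) := by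
  rw [MvPolynomial.eval_eq', sum_mul]
  simp only [mul_assoc, ← prod_mul_distrib, sub_eq_add_neg, zpow_add₀ (Circle.coe_ne_zero _),
    zpow_natCast]

theorem integral_torus_eval_mul_prod_zpow_neg (p : MvPolynomial ι ℂ) (d : ι →₀ ℕ) :
    ∫ x : ι → Circle, MvPolynomial.eval (fun m => (x m : ℂ)) p * ∏ m, (x m : ℂ) ^ (-d m : ℤ)
        ∂(Measure.pi fun _ => circleHaar) =
      p.coeff d := by
  classical
  simp only [eval_mul_prod_zpow_neg]
  rw [integral_finsetSum _ fun e _ => (integrable_torus_prod_zpow _).const_mul _]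
  have hexp (e : ι →₀ ℕ) : (fun m => (e m - d m : ℤ)) = 0 ↔ e = d := by
    simp [funext_iff, sub_eq_zero, DFunLike.ext_iff]
  simp only [integral_const_mul, integral_torus_prod_zpow, hexp, mul_ite, mul_one, mul_zero,
    sum_ite_eq', MvPolynomial.mem_support_iff, ite_not, ite_eq_right_iff]
  exact Eq.symm

theorem norm_sub_pow_two_mul (z w : Circle) (k : ℕ) :
    ((‖(z : ℂ) - w‖ ^ (2 * k) : ℝ) : ℂ) =
      (((z : ℂ) - w) * (w - z)) ^ k * ((z : ℂ) ^ (-k : ℤ) * (w : ℂ) ^ (-k : ℤ)) := by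
  have hsq : ((‖(z : ℂ) - w‖ ^ 2 : ℝ) : ℂ) =
      ((z : ℂ) - w) * (w - z) * ((z : ℂ)⁻¹ * (w : ℂ)⁻¹) := by
    have hz := z.coe_ne_zero
    have hw := w.coe_ne_zero
    rw [Complex.ofReal_pow, ← Complex.mul_conj', map_sub, ← Circle.coe_inv_eq_conj,
      ← Circle.coe_inv_eq_conj, Circle.coe_inv, Circle.coe_inv]
    field_simp
  simp only [pow_mul, Complex.ofReal_pow (‖(z : ℂ) - w‖ ^ 2), hsq, mul_pow, zpow_neg, zpow_natCast,
    inv_pow]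

theorem prod_prod_Ioi_mul_const {A : Type*} [CommMonoid A] {M : ℕ} (f : Fin M → A) :
    ∏ m : Fin M, ∏ n ∈ Ioi m, f n * f m = ∏ m, f m ^ (M - 1) := by
  rw [prod_prod_Ioi_mul_eq_prod_prod_off_diag fun n _ : Fin M => f n,
    prod_comm' (t' := univ) (s' := fun n => {n}ᶜ) (by simp [eq_comm])]
  simp only [prod_const, card_compl, card_singleton, Fintype.card_fin]

theorem prod_norm_sub_pow_two_mul {M : ℕ} (k : ℕ) (x : Fin M → Circle) :
    ((∏ m : Fin M, ∏ n ∈ Ioi m, ‖(x n : ℂ) - x m‖ ^ (2 * k) : ℝ) : ℂ) =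
      MvPolynomial.eval (fun m => (x m : ℂ)) (dysonPoly ℂ univ fun _ => k) *
        ∏ m, (x m : ℂ) ^ (-dysonExponent (univ : Finset (Fin M)) (fun _ => k) m : ℤ) := by
  have hmonomial : ∏ m, (x m : ℂ) ^ (-dysonExponent (univ : Finset (Fin M)) (fun _ => k) m : ℤ) =
      ∏ m, ∏ n ∈ Ioi m, (x n : ℂ) ^ (-k : ℤ) * (x m : ℂ) ^ (-k : ℤ) := by
    rw [prod_prod_Ioi_mul_const fun m => (x m : ℂ) ^ (-k : ℤ)]
    simp only [dysonExponent_univ_const, Finsupp.equivFunOnFinite_symm_apply_apply, Nat.cast_mul,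
      ← neg_mul, zpow_mul, zpow_natCast]
  simp only [hmonomial, Complex.ofReal_prod, norm_sub_pow_two_mul, dysonPoly_univ_const, map_prod,
    map_pow, map_mul, map_sub, MvPolynomial.eval_X, ← prod_mul_distrib]

theorem circularPartitionFunction_two_mul (k M : ℕ) :
    (circularPartitionFunction (2 * k) M : ℂ) =
      (M ! : ℂ)⁻¹ * (Nat.multinomial univ (fun _ : Fin M => k) : ℂ) := by
  have hintegral : ∫ x : Fin M → Circle,
      ((∏ m : Fin M, ∏ n ∈ Ioi m, ‖(x n : ℂ) - x m‖ ^ (2 * k) : ℝ) : ℂ)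
        ∂(Measure.pi fun _ => circleHaar) = Nat.multinomial univ fun _ : Fin M => k := by
    simp only [prod_norm_sub_pow_two_mul, integral_torus_eval_mul_prod_zpow_neg, coeff_dysonPoly]
  rw [circularPartitionFunction, Complex.ofReal_mul, Complex.ofReal_inv, Complex.ofReal_natCast]
  exact congrArg _ (integral_ofReal.symm.trans hintegral)

end Circle

end Hyperpfaffian

theorem mainTheorem4 {𝕜 : Type*} [Field 𝕜] [CharZero 𝕜] (L M β : ℕ)
    (hL : 0 < L) (hLeven : Even L) (hM : 0 < M) (hβ : β = L ^ 2) :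
    Hyperpfaffian.PF (Hyperpfaffian.circularGram 𝕜 L M) =
        (M ! : 𝕜)⁻¹ * (Nat.multinomial Finset.univ (fun _ : Fin M => β / 2) : 𝕜) ∧
      (Hyperpfaffian.circularPartitionFunction β M : ℂ) =
        Hyperpfaffian.PF (Hyperpfaffian.circularGram ℂ L M) := by
  subst hβ
  have heven : L ^ 2 = 2 * (L ^ 2 / 2) :=
    (Nat.mul_div_cancel' (hLeven.pow_of_ne_zero two_ne_zero).two_dvd).symm
  refine ⟨Hyperpfaffian.PF_circularGram hLeven hM, ?_⟩
  rw [Hyperpfaffian.PF_circularGram hLeven hM, ← Hyperpfaffian.circularPartitionFunction_two_mul,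
    ← heven]
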